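/- Let $(\overline M_1,g_1,J_1)$ and $(\overline M_2,g_2,J_2)$ be Kähler manifolds, that is, finite-dimensional smooth manifolds with a smooth Riemannian metric $g_i$ and a smooth almost complex structure $J_i$ ($J_i^2=-I$) such that $g_i(J_iX,J_iY)=g_i(X,Y)$ and $\nabla^{i}J_i=0$ for the Levi-Civita connection $\nabla^i$ of $g_i$. Let $\overline M=\overline M_1\times\overline M_2$ be the Kähler product manifold, with the product metric $g$, the almost complex structure $J=J_1P+J_2Q$ and the almost product structure $F=P-Q$, where $P$ and $Q$ denote the projections of $T\overline M$ onto the parts tangent to $\overline M_1$ and $\overline M_2$. Let $M$ be a smooth (immersed) submanifold of $\overline M$ that is - $F$-anti-invariant: $F(T_xM)\subset T_x(M)^\perp$ for every $x\in M$; and - Lagrangian: $g(JX,Y)=0$ for all $X,Y\in T_xM$ and all $x\in M$, and $\dim_{\mathbb R}M=\tfrac12\dim_{\mathbb R}\overline M$. Then $M$ is totally geodesic in $\overline M$: its second fundamental form $B$, given by the normal part $B(X,Y)=(\overline\nabla_XY)^\perp$ of the Levi-Civita connection $\overline\nabla$ of $g$, vanishes identically. -/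

import Mathlib

open scoped Manifold ContDiff
open Bundle

noncomputable section

namespace KahlerProduct

section Metric

variable {E : Type*} [NormedAddCommGroup E] [NormedSpace ℝ E]
  {H : Type*} [TopologicalSpace H] {I : ModelWithCorners ℝ E H}
  {N : Type*} [TopologicalSpace N] [ChartedSpace H N] [IsManifold I ∞ N]

/-- A smooth Riemannian metric on the manifold `N` (Mathlib's notion, for the tangent bundle). -/
abbrev RiemannianMetric {E : Type*} [NormedAddCommGroup E] [NormedSpace ℝ E]
    {H : Type*} [TopologicalSpace H] (I : ModelWithCorners ℝ E H)
    (N : Type*) [TopologicalSpace N] [ChartedSpace H N] [IsManifold I ∞ N] :=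
  ContMDiffRiemannianMetric I ∞ E (fun p : N => TangentSpace I p)

/-- The metric at the point `p`, as a bilinear form on `T_p N`. -/
def form (g : RiemannianMetric I N) (p : N) : LinearMap.BilinForm ℝ (TangentSpace I p) :=
  (g.inner p).toBilinForm

theorem form_apply (g : RiemannianMetric I N) (p : N) (v w : TangentSpace I p) :
    form g p v w = g.inner p v w := rfl

theorem form_isRefl (g : RiemannianMetric I N) (p : N) : (form g p).IsRefl := by
  intro v w h
  rw [form_apply] at h ⊢
  rw [g.symm, h]

theorem form_eq_zero (g : RiemannianMetric I N) (p : N) (v : TangentSpace I p)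
    (h : form g p v v = 0) : v = 0 := by
  by_contra hv
  exact (g.pos p v hv).ne' h

theorem form_nondegenerate (g : RiemannianMetric I N) (p : N) : (form g p).Nondegenerate :=
  ⟨fun v hv => form_eq_zero g p v (hv v), fun v hv => form_eq_zero g p v (hv v)⟩

/-- The Riesz isomorphism `T_p N ≃ (T_p N)*`, `v ↦ g(v, ·)`. -/
def flat [FiniteDimensional ℝ E] (g : RiemannianMetric I N) (p : N) :
    TangentSpace I p ≃ₗ[ℝ] Module.Dual ℝ (TangentSpace I p) :=
  haveI : FiniteDimensional ℝ (TangentSpace I p) := inferInstanceAs (FiniteDimensional ℝ E)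
  (form g p).toDual (form_nondegenerate g p)

/-- The components of the metric at `q` in the chart at `p`: `g_q(∂_v, ∂_w)`, where for `v : E` the
coordinate vector field `∂_v` is the vector field with constant value `v` in the chart at `p`. -/
def metricCoord (g : RiemannianMetric I N) (p q : N) : E →L[ℝ] E →L[ℝ] ℝ :=
  (trivializationAt (E →L[ℝ] E →L[ℝ] ℝ)
    (fun q : N => TangentSpace I q →L[ℝ] TangentSpace I q →L[ℝ] ℝ) p ⟨q, g.inner q⟩).2

theorem hom_coord_apply (p q : N) (hq : q ∈ (chartAt H p).source)
    (b : TangentSpace I q →L[ℝ] TangentSpace I q →L[ℝ] ℝ) (v w : E) :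
    (trivializationAt (E →L[ℝ] E →L[ℝ] ℝ)
      (fun q : N => TangentSpace I q →L[ℝ] TangentSpace I q →L[ℝ] ℝ) p ⟨q, b⟩).2 v w =
      b ((trivializationAt E (TangentSpace I) p).symmL ℝ q v)
        ((trivializationAt E (TangentSpace I) p).symmL ℝ q w) := by
  have h1 : q ∈ (trivializationAt (E →L[ℝ] ℝ) (fun q : N => TangentSpace I q →L[ℝ] ℝ) p).baseSet := by
    rw [hom_trivializationAt_baseSet]
    exact ⟨hq, Set.mem_univ _⟩
  rw [hom_trivializationAt_apply]
  simp only [ContinuousLinearMap.inCoordinates, ContinuousLinearMap.comp_apply]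
  rw [Trivialization.continuousLinearMapAt_apply, Trivialization.linearMapAt_apply, if_pos h1,
    hom_trivializationAt_apply]
  simp [ContinuousLinearMap.inCoordinates]

theorem metricCoord_apply (g : RiemannianMetric I N) (p q : N) (hq : q ∈ (chartAt H p).source)
    (v w : E) :
    metricCoord g p q v w =
      g.inner q ((trivializationAt E (TangentSpace I) p).symmL ℝ q v)
        ((trivializationAt E (TangentSpace I) p).symmL ℝ q w) :=
  hom_coord_apply p q hq _ v w

end Metric

section Pullback

variable {E : Type*} [NormedAddCommGroup E] [NormedSpace ℝ E]
  {H : Type*} [TopologicalSpace H] {I : ModelWithCorners ℝ E H}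
  {M : Type*} [TopologicalSpace M] [ChartedSpace H M]
  {E' : Type*} [NormedAddCommGroup E'] [NormedSpace ℝ E']
  {H' : Type*} [TopologicalSpace H'] {I' : ModelWithCorners ℝ E' H'}
  {N : Type*} [TopologicalSpace N] [ChartedSpace H' N] [IsManifold I' ∞ N]

set_option synthInstance.maxHeartbeats 400000 in
theorem contMDiffAt_flip {F F' : Type*} [NormedAddCommGroup F] [NormedSpace ℝ F]
    [NormedAddCommGroup F'] [NormedSpace ℝ F'] {a : M → F →L[ℝ] F' →L[ℝ] ℝ} {x : M}
    (ha : ContMDiffAt I 𝓘(ℝ, F →L[ℝ] F' →L[ℝ] ℝ) ∞ a x) :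
    ContMDiffAt I 𝓘(ℝ, F' →L[ℝ] F →L[ℝ] ℝ) ∞ (fun y => (a y).flip) x := by
  have h : ContDiff ℝ ∞ (ContinuousLinearMap.flip : (F →L[ℝ] F' →L[ℝ] ℝ) → _) :=
    ContinuousLinearMap.contDiff (n := ∞) (𝕜 := ℝ) (E := F →L[ℝ] F' →L[ℝ] ℝ)
      (F := F' →L[ℝ] F →L[ℝ] ℝ) (ContinuousLinearMap.flipₗᵢ ℝ F F' ℝ).toContinuousLinearEquiv
  exact (h.contMDiff.contMDiffAt (x := a x)).comp x ha

/-- The pullback `(φ^* g)_x(v, w) = g_{φ x}(dφ v, dφ w)`. -/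
def pullbackInner (g : RiemannianMetric I' N) (φ : M → N) (x : M) :
    TangentSpace I x →L[ℝ] TangentSpace I x →L[ℝ] ℝ :=
  ((mfderiv I I' φ x).precomp ℝ) ∘L (g.inner (φ x)) ∘L (mfderiv I I' φ x)

theorem pullbackInner_apply (g : RiemannianMetric I' N) (φ : M → N) (x : M)
    (v w : TangentSpace I x) :
    pullbackInner (I := I) g φ x v w =
      g.inner (φ x) (mfderiv I I' φ x v) (mfderiv I I' φ x w) := rfl

variable [IsManifold I ∞ M]

theorem contMDiff_pullbackInner (g : RiemannianMetric I' N) (φ : M → N)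
    (hφ : ContMDiff I I' ∞ φ) :
    ContMDiff I (I.prod 𝓘(ℝ, E →L[ℝ] E →L[ℝ] ℝ)) ∞
      (fun x : M => TotalSpace.mk' (E →L[ℝ] E →L[ℝ] ℝ)
        (E := fun x : M => TangentSpace I x →L[ℝ] TangentSpace I x →L[ℝ] ℝ)
        x (pullbackInner g φ x)) := by
  intro x₀
  rw [contMDiffAt_section]
  have hG : ContMDiffAt I 𝓘(ℝ, E' →L[ℝ] E' →L[ℝ] ℝ) ∞
      (fun x => metricCoord g (φ x₀) (φ x)) x₀ :=
    ((contMDiffAt_section _).1 (g.contMDiff (φ x₀))).comp x₀ (hφ x₀)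
  have hD : ContMDiffAt I 𝓘(ℝ, E →L[ℝ] E') ∞
      (inTangentCoordinates I I' id φ (mfderiv I I' φ) x₀) x₀ :=
    (hφ x₀).mfderiv_const (m := ∞) (by simp)
  have key := contMDiffAt_flip ((contMDiffAt_flip (hG.clm_comp hD)).clm_comp hD)
  refine key.congr_of_eventuallyEq ?_
  have h1 : ∀ᶠ x in nhds x₀, x ∈ (chartAt H x₀).source :=
    (chartAt H x₀).open_source.mem_nhds (mem_chart_source H x₀)
  have h2 : ∀ᶠ x in nhds x₀, φ x ∈ (chartAt H' (φ x₀)).source :=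
    (hφ x₀).continuousAt ((chartAt H' (φ x₀)).open_source.mem_nhds (mem_chart_source H' (φ x₀)))
  filter_upwards [h1, h2] with x hx hx'
  ext v w
  rw [hom_coord_apply x₀ x hx, pullbackInner_apply]
  simp only [ContinuousLinearMap.flip_apply, ContinuousLinearMap.comp_apply]
  rw [metricCoord_apply g _ _ hx']
  have : ∀ u : E, (trivializationAt E' (TangentSpace I') (φ x₀)).symmL ℝ (φ x)
      (inTangentCoordinates I I' id φ (mfderiv I I' φ) x₀ x u) =
      mfderiv I I' φ x ((trivializationAt E (TangentSpace I) x₀).symmL ℝ x u) := fun u =>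
    Trivialization.symmL_continuousLinearMapAt _ hx' _
  rw [this, this]

end Pullback

section Product

variable {E₁ : Type*} [NormedAddCommGroup E₁] [NormedSpace ℝ E₁]
  {H₁ : Type*} [TopologicalSpace H₁] {I₁ : ModelWithCorners ℝ E₁ H₁}
  {M₁ : Type*} [TopologicalSpace M₁] [ChartedSpace H₁ M₁]
  {E₂ : Type*} [NormedAddCommGroup E₂] [NormedSpace ℝ E₂]
  {H₂ : Type*} [TopologicalSpace H₂] {I₂ : ModelWithCorners ℝ E₂ H₂}
  {M₂ : Type*} [TopologicalSpace M₂] [ChartedSpace H₂ M₂]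

/-- The differential `T_p (M₁ × M₂) → T_{p₁} M₁` of the first projection. -/
def dfst (I₁ : ModelWithCorners ℝ E₁ H₁) (I₂ : ModelWithCorners ℝ E₂ H₂) (p : M₁ × M₂) :
    TangentSpace (I₁.prod I₂) p →L[ℝ] TangentSpace I₁ p.1 :=
  mfderiv (I₁.prod I₂) I₁ Prod.fst p

/-- The differential `T_p (M₁ × M₂) → T_{p₂} M₂` of the second projection. -/
def dsnd (I₁ : ModelWithCorners ℝ E₁ H₁) (I₂ : ModelWithCorners ℝ E₂ H₂) (p : M₁ × M₂) :
    TangentSpace (I₁.prod I₂) p →L[ℝ] TangentSpace I₂ p.2 :=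
  mfderiv (I₁.prod I₂) I₂ Prod.snd p

/-- The differential at `p₁` of the inclusion `x ↦ (x, p₂)` of the first leaf through `p`. -/
def dinl (I₁ : ModelWithCorners ℝ E₁ H₁) (I₂ : ModelWithCorners ℝ E₂ H₂) (p : M₁ × M₂) :
    TangentSpace I₁ p.1 →L[ℝ] TangentSpace (I₁.prod I₂) p :=
  mfderiv I₁ (I₁.prod I₂) (fun x => (x, p.2)) p.1

/-- The differential at `p₂` of the inclusion `y ↦ (p₁, y)` of the second leaf through `p`. -/
def dinr (I₁ : ModelWithCorners ℝ E₁ H₁) (I₂ : ModelWithCorners ℝ E₂ H₂) (p : M₁ × M₂) :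
    TangentSpace I₂ p.2 →L[ℝ] TangentSpace (I₁.prod I₂) p :=
  mfderiv I₂ (I₁.prod I₂) (fun y => (p.1, y)) p.2

theorem dinl_dfst_add_dinr_dsnd (p : M₁ × M₂) (v : TangentSpace (I₁.prod I₂) p) :
    dinl I₁ I₂ p (dfst I₁ I₂ p v) + dinr I₁ I₂ p (dsnd I₁ I₂ p v) = v := by
  have h1 : dfst I₁ I₂ p =
      ContinuousLinearMap.fst ℝ (TangentSpace I₁ p.1) (TangentSpace I₂ p.2) := mfderiv_fst
  have h2 : dsnd I₁ I₂ p =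
      ContinuousLinearMap.snd ℝ (TangentSpace I₁ p.1) (TangentSpace I₂ p.2) := mfderiv_snd
  have h3 : dinl I₁ I₂ p =
      ContinuousLinearMap.inl ℝ (TangentSpace I₁ p.1) (TangentSpace I₂ p.2) := mfderiv_prod_left
  have h4 : dinr I₁ I₂ p =
      ContinuousLinearMap.inr ℝ (TangentSpace I₁ p.1) (TangentSpace I₂ p.2) := mfderiv_prod_right
  rw [h1, h2, h3, h4]
  obtain ⟨a, b⟩ : E₁ × E₂ := v
  exact Prod.ext (add_zero a) (zero_add b)

variable [IsManifold I₁ ∞ M₁] [IsManifold I₂ ∞ M₂]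

/-- The product metric `g(X, Y) = g₁(dπ₁ X, dπ₁ Y) + g₂(dπ₂ X, dπ₂ Y)` on `M₁ × M₂`. -/
def prodMetric (g₁ : RiemannianMetric I₁ M₁) (g₂ : RiemannianMetric I₂ M₂) :
    RiemannianMetric (I₁.prod I₂) (M₁ × M₂) where
  inner p := pullbackInner g₁ Prod.fst p + pullbackInner g₂ Prod.snd p
  symm p v w := by
    change g₁.inner p.1 (dfst I₁ I₂ p v) (dfst I₁ I₂ p w) +
        g₂.inner p.2 (dsnd I₁ I₂ p v) (dsnd I₁ I₂ p w) =
      g₁.inner p.1 (dfst I₁ I₂ p w) (dfst I₁ I₂ p v) +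
        g₂.inner p.2 (dsnd I₁ I₂ p w) (dsnd I₁ I₂ p v)
    rw [g₁.symm, g₂.symm]
  pos p v hv := by
    change 0 < g₁.inner p.1 (dfst I₁ I₂ p v) (dfst I₁ I₂ p v) +
        g₂.inner p.2 (dsnd I₁ I₂ p v) (dsnd I₁ I₂ p v)
    by_cases h1 : dfst I₁ I₂ p v = 0
    · by_cases h2 : dsnd I₁ I₂ p v = 0
      · refine absurd ?_ hv
        rw [← dinl_dfst_add_dinr_dsnd p v, h1, h2, map_zero, map_zero, add_zero]
      · rw [h1, map_zero, zero_add]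
        exact g₂.pos _ _ h2
    · have h := g₁.pos _ _ h1
      by_cases h2 : dsnd I₁ I₂ p v = 0
      · rw [h2, map_zero, add_zero]
        exact h
      · exact add_pos h (g₂.pos _ _ h2)
  isVonNBounded p := by
    refine (((g₁.isVonNBounded p.1).image (dinl I₁ I₂ p)).add
      ((g₂.isVonNBounded p.2).image (dinr I₁ I₂ p))).subset ?_
    intro v hv
    have hv' : g₁.inner p.1 (dfst I₁ I₂ p v) (dfst I₁ I₂ p v) +
        g₂.inner p.2 (dsnd I₁ I₂ p v) (dsnd I₁ I₂ p v) < 1 := hv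
    have n1 : 0 ≤ g₁.inner p.1 (dfst I₁ I₂ p v) (dfst I₁ I₂ p v) := by
      by_cases h : dfst I₁ I₂ p v = 0
      · rw [h, map_zero]
      · exact (g₁.pos _ _ h).le
    have n2 : 0 ≤ g₂.inner p.2 (dsnd I₁ I₂ p v) (dsnd I₁ I₂ p v) := by
      by_cases h : dsnd I₁ I₂ p v = 0
      · rw [h, map_zero]
      · exact (g₂.pos _ _ h).le
    refine Set.mem_add.2 ⟨_, ⟨dfst I₁ I₂ p v, ?_, rfl⟩, _, ⟨dsnd I₁ I₂ p v, ?_, rfl⟩,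
      dinl_dfst_add_dinr_dsnd p v⟩
    · change g₁.inner p.1 (dfst I₁ I₂ p v) (dfst I₁ I₂ p v) < 1
      linarith
    · change g₂.inner p.2 (dsnd I₁ I₂ p v) (dsnd I₁ I₂ p v) < 1
      linarith
  contMDiff := by
    intro p
    have h1 := (contMDiffAt_section _).1 (contMDiff_pullbackInner g₁ (Prod.fst : M₁ × M₂ → M₁)
      (contMDiff_fst (I := I₁) (J := I₂)) p)
    have h2 := (contMDiffAt_section _).1 (contMDiff_pullbackInner g₂ (Prod.snd : M₁ × M₂ → M₂)
      (contMDiff_snd (I := I₁) (J := I₂)) p)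
    rw [contMDiffAt_section]
    refine (h1.add h2).congr_of_eventuallyEq ?_
    have h3 : ∀ᶠ x in nhds p, x ∈ (chartAt (ModelProd H₁ H₂) p).source :=
      (chartAt (ModelProd H₁ H₂) p).open_source.mem_nhds (mem_chart_source _ p)
    filter_upwards [h3] with x hx
    refine ContinuousLinearMap.ext fun v => ContinuousLinearMap.ext fun w => ?_
    rw [hom_coord_apply p x hx]
    exact (congrArg₂ (· + ·) (hom_coord_apply p x hx (pullbackInner g₁ Prod.fst x) v w)
      (hom_coord_apply p x hx (pullbackInner g₂ Prod.snd x) v w)).symm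

/-- The almost complex structure `J X = J₁ P X + J₂ Q X` on `M₁ × M₂`. -/
def prodJ (J₁ : ∀ p : M₁, TangentSpace I₁ p →L[ℝ] TangentSpace I₁ p)
    (J₂ : ∀ p : M₂, TangentSpace I₂ p →L[ℝ] TangentSpace I₂ p) (p : M₁ × M₂) :
    TangentSpace (I₁.prod I₂) p →L[ℝ] TangentSpace (I₁.prod I₂) p :=
  dinl I₁ I₂ p ∘L J₁ p.1 ∘L dfst I₁ I₂ p + dinr I₁ I₂ p ∘L J₂ p.2 ∘L dsnd I₁ I₂ p

/-- The almost product structure `F = P - Q` on `M₁ × M₂`, where `P` and `Q` are the projections of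
`T_p (M₁ × M₂)` onto the parts tangent to `M₁` and to `M₂`. -/
def prodF (I₁ : ModelWithCorners ℝ E₁ H₁) (I₂ : ModelWithCorners ℝ E₂ H₂) (p : M₁ × M₂) :
    TangentSpace (I₁.prod I₂) p →L[ℝ] TangentSpace (I₁.prod I₂) p :=
  dinl I₁ I₂ p ∘L dfst I₁ I₂ p - dinr I₁ I₂ p ∘L dsnd I₁ I₂ p

end Product

section Connection

variable {E : Type*} [NormedAddCommGroup E] [NormedSpace ℝ E] [FiniteDimensional ℝ E]
  {H : Type*} [TopologicalSpace H] {I : ModelWithCorners ℝ E H}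
  {N : Type*} [TopologicalSpace N] [ChartedSpace H N] [IsManifold I ∞ N]

set_option synthInstance.maxHeartbeats 400000 in
/-- The functional `c ↦ (a(g(∂_b, ∂_c)) + b(g(∂_a, ∂_c)) - c(g(∂_a, ∂_b))) / 2` on `T_p N`, where
`∂_a, ∂_b, ∂_c` are the coordinate vector fields of the chart at `p` extending `a, b, c ∈ T_p N`:
the Koszul formula for `g(∇_a ∂_b, c)`, or the Christoffel symbols of the first kind at `p`. -/
def koszul (g : RiemannianMetric I N) (p : N) (a b : TangentSpace I p) :
    Module.Dual ℝ (TangentSpace I p) :=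
  let κ := (trivializationAt E (TangentSpace I) p).continuousLinearMapAt ℝ p
  let dg : TangentSpace I p →L[ℝ] E →L[ℝ] E →L[ℝ] ℝ := mvfderiv I (metricCoord g p) p
  { toFun := fun c => (dg a (κ b) (κ c) + dg b (κ a) (κ c) - dg c (κ a) (κ b)) / 2
    map_add' := fun c c' => by
      rw [map_add κ, ContinuousLinearMap.map_add dg, map_add (dg a (κ b)), map_add (dg b (κ a))]
      change (_ + _ - ((dg c) (κ a) (κ b) + (dg c') (κ a) (κ b))) / 2 = _
      ring
    map_smul' := fun r c => by
      rw [map_smul κ, ContinuousLinearMap.map_smul dg, map_smul (dg a (κ b)), map_smul (dg b (κ a))]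
      change (r * _ + r * _ - r * (dg c) (κ a) (κ b)) / 2 = r * _
      ring }

/-- The Christoffel symbols of the second kind `Γ_p(a, b) = ∇_a ∂_b ∈ T_p N` of the Levi-Civita
connection, in the chart at `p`: the vector with `g(Γ_p(a, b), c) = koszul g p a b c`. -/
def christoffel (g : RiemannianMetric I N) (p : N) (a b : TangentSpace I p) : TangentSpace I p :=
  (flat g p).symm (koszul g p a b)

theorem inner_christoffel (g : RiemannianMetric I N) (p : N) (a b c : TangentSpace I p) :
    g.inner p (christoffel g p a b) c = koszul g p a b c :=
  LinearMap.congr_fun ((flat g p).apply_symm_apply (koszul g p a b)) c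

variable {E' : Type*} [NormedAddCommGroup E'] [NormedSpace ℝ E']
  {H' : Type*} [TopologicalSpace H'] {I' : ModelWithCorners ℝ E' H'}
  {M : Type*} [TopologicalSpace M] [ChartedSpace H' M]

/-- The Levi-Civita covariant derivative `∇_v V` at `x`, for a map `φ : M → N`, a vector field `V`
along `φ` and `v ∈ T_x M`. In the chart of `N` at `φ x` it is `∂_v V + Γ(dφ v, V)`. -/
def covDerivAlong (I' : ModelWithCorners ℝ E' H') (g : RiemannianMetric I N) (φ : M → N)
    (V : ∀ x : M, TangentSpace I (φ x)) (x : M) (v : TangentSpace I' x) : TangentSpace I (φ x) :=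
  (trivializationAt E (TangentSpace I) (φ x)).symmL ℝ (φ x)
      (mvfderiv I' (fun y : M => (trivializationAt E (TangentSpace I) (φ x) ⟨φ y, V y⟩).2) x v) +
    christoffel g (φ x) (mfderiv I' I φ x v) (V x)

/-- The Levi-Civita connection `∇_v Y` of the Riemannian manifold `(N, g)`. -/
def covDeriv (g : RiemannianMetric I N) (Y : ∀ p : N, TangentSpace I p) (p : N)
    (v : TangentSpace I p) : TangentSpace I p :=
  covDerivAlong I g id Y p v

/-- A Kähler structure on the manifold `N`: a Riemannian metric `g` and a smooth almost complex
structure `J`, with `g(JX, JY) = g(X, Y)` and `∇J = 0`. -/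
structure KahlerStructure {E : Type*} [NormedAddCommGroup E] [NormedSpace ℝ E]
    [FiniteDimensional ℝ E] {H : Type*} [TopologicalSpace H] (I : ModelWithCorners ℝ E H)
    (N : Type*) [TopologicalSpace N] [ChartedSpace H N] [IsManifold I ∞ N] where
  /-- The metric `g`. -/
  metric : RiemannianMetric I N
  /-- The almost complex structure. -/
  J : ∀ p : N, TangentSpace I p →L[ℝ] TangentSpace I p
  contMDiff_J : ContMDiff I (I.prod 𝓘(ℝ, E →L[ℝ] E)) ∞
    (fun p : N => TotalSpace.mk' (E →L[ℝ] E)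
      (E := fun p : N => TangentSpace I p →L[ℝ] TangentSpace I p) p (J p))
  J_J : ∀ (p : N) (v : TangentSpace I p), J p (J p v) = -v
  inner_J_J : ∀ (p : N) (v w : TangentSpace I p),
    metric.inner p (J p v) (J p w) = metric.inner p v w
  /-- `∇J = 0`, that is, `∇_v (J Y) = J (∇_v Y)`. -/
  parallel_J : ∀ (Y : ∀ p : N, TangentSpace I p) (p : N) (v : TangentSpace I p),
    ContMDiffAt I (I.prod 𝓘(ℝ, E)) ∞ (fun q => (⟨q, Y q⟩ : TangentBundle I N)) p →
      covDeriv metric (fun q => J q (Y q)) p v = J p (covDeriv metric Y p v)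

/-! Submanifolds are immersed: a submanifold of `N` is an immersion `φ : M → N`. -/

/-- `φ : M → N` is a smooth immersion. -/
def IsSmoothImmersion (I' : ModelWithCorners ℝ E' H') (I : ModelWithCorners ℝ E H) (φ : M → N) :
    Prop :=
  ContMDiff I' I ∞ φ ∧ ∀ x, Function.Injective (mfderiv I' I φ x)

/-- The tangent space `dφ(T_x M)` of the submanifold, as a subspace of `T_{φ x} N`. -/
def tangentImage (I' : ModelWithCorners ℝ E' H') (I : ModelWithCorners ℝ E H) (φ : M → N) (x : M) :
    Submodule ℝ (TangentSpace I (φ x)) :=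
  LinearMap.range (mfderiv I' I φ x).toLinearMap

/-- The normal space `T_x(M)^⊥ ⊆ T_{φ x} N` of the submanifold. -/
def normalSpace (I' : ModelWithCorners ℝ E' H') (g : RiemannianMetric I N) (φ : M → N) (x : M) :
    Submodule ℝ (TangentSpace I (φ x)) :=
  (form g (φ x)).orthogonal (tangentImage I' I φ x)

theorem isCompl_normalSpace (g : RiemannianMetric I N) (φ : M → N) (x : M) :
    IsCompl (normalSpace I' g φ x) (tangentImage I' I φ x) := by
  have : FiniteDimensional ℝ (TangentSpace I (φ x)) := inferInstanceAs (FiniteDimensional ℝ E)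
  refine IsCompl.symm ((LinearMap.BilinForm.isCompl_orthogonal_iff_disjoint
    (form_isRefl g (φ x))).2 (Submodule.disjoint_def.2 fun v hv hv' => ?_))
  exact form_eq_zero g (φ x) v (hv' v hv)

/-- The orthogonal projection `T_{φ x} N → T_x(M)^⊥`. -/
def normalPart (I' : ModelWithCorners ℝ E' H') (g : RiemannianMetric I N) (φ : M → N) (x : M) :
    TangentSpace I (φ x) →ₗ[ℝ] TangentSpace I (φ x) :=
  Submodule.projection _ _ (isCompl_normalSpace (I' := I') g φ x)

/-- The second fundamental form `B(v, Y)` at `x` of the submanifold, for `v ∈ T_x M` and a vector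
field `Y` on `M`: the normal part of `∇_v (dφ Y)`, as in the Gauss formula. -/
def secondFundamentalForm (g : RiemannianMetric I N) (φ : M → N) (x : M) (v : TangentSpace I' x)
    (Y : ∀ x : M, TangentSpace I' x) : TangentSpace I (φ x) :=
  normalPart I' g φ x (covDerivAlong I' g φ (fun y => mfderiv I' I φ y (Y y)) x v)

/-- The submanifold is totally geodesic: its second fundamental form vanishes. -/
def IsTotallyGeodesic (I' : ModelWithCorners ℝ E' H') [IsManifold I' ∞ M]
    (g : RiemannianMetric I N) (φ : M → N) : Prop :=
  ∀ (x : M) (v : TangentSpace I' x) (Y : ∀ x : M, TangentSpace I' x),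
    ContMDiffAt I' (I'.prod 𝓘(ℝ, E')) ∞ (fun y => (⟨y, Y y⟩ : TangentBundle I' M)) x →
      secondFundamentalForm g φ x v Y = 0

/-- The submanifold is `F`-anti-invariant for the field `F` of endomorphisms of `TN`:
`F(T_x M) ⊆ T_x(M)^⊥` for all `x`. -/
def IsAntiInvariant (I' : ModelWithCorners ℝ E' H') (g : RiemannianMetric I N)
    (F : ∀ p : N, TangentSpace I p →L[ℝ] TangentSpace I p) (φ : M → N) : Prop :=
  ∀ (x : M) (v : TangentSpace I' x), F (φ x) (mfderiv I' I φ x v) ∈ normalSpace I' g φ x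

/-- The submanifold is Lagrangian in `(N, g, J)`: the form `ω(X, Y) = g(JX, Y)` vanishes on it, and
its dimension is half of the dimension of `N`. -/
def IsLagrangian (I' : ModelWithCorners ℝ E' H') (g : RiemannianMetric I N)
    (J : ∀ p : N, TangentSpace I p →L[ℝ] TangentSpace I p) (φ : M → N) : Prop :=
  2 * Module.finrank ℝ E' = Module.finrank ℝ E ∧
    ∀ (x : M) (v w : TangentSpace I' x),
      g.inner (φ x) (J (φ x) (mfderiv I' I φ x v)) (mfderiv I' I φ x w) = 0

end Connection

end KahlerProduct

end

open scoped Manifold ContDiff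
open Bundle

noncomputable section

namespace KahlerProduct

section Calculus

variable {E : Type*} [NormedAddCommGroup E] [NormedSpace ℝ E]
  {H : Type*} [TopologicalSpace H] {I : ModelWithCorners ℝ E H}
  {M : Type*} [TopologicalSpace M] [ChartedSpace H M]
  {F F' : Type*} [NormedAddCommGroup F] [NormedSpace ℝ F]
  [NormedAddCommGroup F'] [NormedSpace ℝ F']

theorem mvfderiv_congr {f g : M → F} {x : M} (h : f =ᶠ[nhds x] g) (v : TangentSpace I x) :
    mvfderiv I f x v = mvfderiv I g x v := by
  have := h.mfderiv_eq (I := I) (I' := 𝓘(ℝ, F))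
  exact congrArg (fun L : E →L[ℝ] F => L v) this

theorem mvfderiv_clm_apply {a : M → F →L[ℝ] F'} {b : M → F} {x : M}
    (ha : MDifferentiableAt I 𝓘(ℝ, F →L[ℝ] F') a x) (hb : MDifferentiableAt I 𝓘(ℝ, F) b x)
    (v : TangentSpace I x) :
    mvfderiv I (fun y => a y (b y)) x v = mvfderiv I a x v (b x) + a x (mvfderiv I b x v) := by
  have h : HasMFDerivAt I 𝓘(ℝ, F') (fun y => a y (b y)) x _ :=
    ⟨ha.continuousAt.clm_apply hb.continuousAt, ha.hasMFDerivAt.2.clm_apply hb.hasMFDerivAt.2⟩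
  have h2 := congrArg (fun L : E →L[ℝ] F' => L v) h.mfderiv
  refine h2.trans ?_
  simp [writtenInExtChartAt]
  exact add_comm _ _

theorem mvfderiv_apply_const {a : M → F →L[ℝ] F'} {x : M}
    (ha : MDifferentiableAt I 𝓘(ℝ, F →L[ℝ] F') a x) (c : F) (v : TangentSpace I x) :
    mvfderiv I (fun y => a y c) x v = mvfderiv I a x v c := by
  rw [mvfderiv_clm_apply ha mdifferentiableAt_const, mvfderiv_const]
  simp

theorem mvfderiv_const_clm_apply (L : F →L[ℝ] F') {b : M → F} {x : M}
    (hb : MDifferentiableAt I 𝓘(ℝ, F) b x) (v : TangentSpace I x) :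
    mvfderiv I (fun y => L (b y)) x v = L (mvfderiv I b x v) := by
  rw [mvfderiv_clm_apply mdifferentiableAt_const hb, mvfderiv_const]
  simp

theorem mvfderiv_comp_vector {E' : Type*} [NormedAddCommGroup E'] [NormedSpace ℝ E']
    {H' : Type*} [TopologicalSpace H'] {I' : ModelWithCorners ℝ E' H'}
    {N : Type*} [TopologicalSpace N] [ChartedSpace H' N] {f : N → F} {φ : M → N} {x : M}
    (hf : MDifferentiableAt I' 𝓘(ℝ, F) f (φ x)) (hφ : MDifferentiableAt I I' φ x)
    (v : TangentSpace I x) :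
    mvfderiv I (fun y => f (φ y)) x v = mvfderiv I' f (φ x) (mfderiv I I' φ x v) :=
  congrArg (fun L : E →L[ℝ] F => L v) (mfderiv_comp x hf hφ)

/-- In the preferred chart, the manifold derivative of a vector-valued function is its
Fréchet derivative. -/
theorem mvfderiv_eq_fderiv [I.Boundaryless] {f : M → F} {x : M}
    (hf : MDifferentiableAt I 𝓘(ℝ, F) f x) (v : TangentSpace I x) :
    mvfderiv I f x v = fderiv ℝ (f ∘ (extChartAt I x).symm) (extChartAt I x x) v := by
  rw [hf.mvfderiv, I.range_eq_univ, fderivWithin_univ]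
  rfl

end Calculus

section Differential

variable {E : Type*} [NormedAddCommGroup E] [NormedSpace ℝ E]
  {H : Type*} [TopologicalSpace H] {I : ModelWithCorners ℝ E H}
  {M : Type*} [TopologicalSpace M] [ChartedSpace H M] [IsManifold I ∞ M]
  {E' : Type*} [NormedAddCommGroup E'] [NormedSpace ℝ E']
  {H' : Type*} [TopologicalSpace H'] {I' : ModelWithCorners ℝ E' H'}
  {N : Type*} [TopologicalSpace N] [ChartedSpace H' N] [IsManifold I' ∞ N]

/-- The differential of `φ` at `y`, in the charts at `x` and `φ x`. -/
def mfderivCoord (I : ModelWithCorners ℝ E H) (I' : ModelWithCorners ℝ E' H') [IsManifold I ∞ M]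
    [IsManifold I' ∞ N] (φ : M → N) (x y : M) : E →L[ℝ] E' :=
  inTangentCoordinates I I' id φ (mfderiv I I' φ) x y

theorem contMDiffAt_mfderivCoord {φ : M → N} (hφ : ContMDiff I I' ∞ φ) (x : M) :
    ContMDiffAt I 𝓘(ℝ, E →L[ℝ] E') ∞ (mfderivCoord I I' φ x) x :=
  (hφ x).mfderiv_const (m := ∞) (by simp)

omit [IsManifold I ∞ M] [IsManifold I' ∞ N] in
theorem eventually_mem_chartAt_source {φ : M → N} (hφ : ContMDiff I I' ∞ φ) (x : M) :
    ∀ᶠ y in nhds x, y ∈ (chartAt H x).source ∧ φ y ∈ (chartAt H' (φ x)).source :=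
  Filter.Eventually.and ((chartAt H x).open_source.mem_nhds (mem_chart_source H x))
    ((hφ x).continuousAt ((chartAt H' (φ x)).open_source.mem_nhds (mem_chart_source H' (φ x))))

/-- `mfderivCoord` is the Fréchet derivative of `φ` read in charts. -/
theorem mfderivCoord_eq_fderiv [I.Boundaryless] {φ : M → N} (hφ : ContMDiff I I' ∞ φ) {x y : M}
    (hy : y ∈ (chartAt H x).source) (hy' : φ y ∈ (chartAt H' (φ x)).source) :
    mfderivCoord I I' φ x y =
      fderiv ℝ (extChartAt I' (φ x) ∘ φ ∘ (extChartAt I x).symm) (extChartAt I x y) := by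
  rw [mfderivCoord, inTangentCoordinates_eq_mfderiv_comp hy hy', I.range_eq_univ,
    mfderivWithin_univ]
  have hs : (extChartAt I x).symm (extChartAt I x y) = y :=
    (extChartAt I x).left_inv (by rwa [extChartAt_source])
  have h1 : MDifferentiableAt 𝓘(ℝ, E) I (extChartAt I x).symm (extChartAt I x y) := by
    have := mdifferentiableWithinAt_extChartAt_symm (I := I)
      ((extChartAt I x).map_source (x := y) (by rwa [extChartAt_source]))
    rwa [I.range_eq_univ, mdifferentiableWithinAt_univ] at this
  have h2 : MDifferentiableAt I I' φ ((extChartAt I x).symm (extChartAt I x y)) :=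
    (hφ _).mdifferentiableAt (by simp)
  have h3 : MDifferentiableAt I' 𝓘(ℝ, E') (extChartAt I' (φ x))
      (φ ((extChartAt I x).symm (extChartAt I x y))) := by
    rw [hs]; exact mdifferentiableAt_extChartAt hy'
  have := mfderiv_comp (extChartAt I x y) h3 (h2.comp _ h1)
  rw [← mfderiv_eq_fderiv, this, mfderiv_comp _ h2 h1]
  simp only [Function.comp_apply, id]
  rw [hs]
  rfl

theorem mvfderiv_mfderivCoord_symm [I.Boundaryless] {φ : M → N} (hφ : ContMDiff I I' ∞ φ) (x : M)
    (v w : TangentSpace I x) :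
    mvfderiv I (mfderivCoord I I' φ x) x v w = mvfderiv I (mfderivCoord I I' φ x) x w v := by
  have h2 : ∀ᶠ u in nhds (extChartAt I x x), (extChartAt I x).symm u ∈ (chartAt H x).source ∧
      φ ((extChartAt I x).symm u) ∈ (chartAt H' (φ x)).source := by
    have := (continuousAt_extChartAt_symm (I := I) x).tendsto.eventually
      (p := fun y => y ∈ (chartAt H x).source ∧ φ y ∈ (chartAt H' (φ x)).source)
    rw [(extChartAt I x).left_inv (mem_extChartAt_source x)] at this
    exact this (eventually_mem_chartAt_source hφ x)
  have h3 : ∀ᶠ u in nhds (extChartAt I x x), u ∈ (extChartAt I x).target :=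
    extChartAt_target_mem_nhds x
  have h4 : mfderivCoord I I' φ x ∘ (extChartAt I x).symm =ᶠ[nhds (extChartAt I x x)]
      fderiv ℝ (extChartAt I' (φ x) ∘ φ ∘ (extChartAt I x).symm) := by
    filter_upwards [h2, h3] with u hu hu'
    rw [Function.comp_apply, mfderivCoord_eq_fderiv hφ hu.1 hu.2, (extChartAt I x).right_inv hu']
  have h5 : ContDiffAt ℝ ∞ (extChartAt I' (φ x) ∘ φ ∘ (extChartAt I x).symm)
      (extChartAt I x x) := by
    have := (contMDiffAt_iff.1 (hφ x)).2
    rwa [I.range_eq_univ, contDiffWithinAt_univ] at this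
  have h6 := (contMDiffAt_mfderivCoord hφ x).mdifferentiableAt (by simp)
  rw [mvfderiv_eq_fderiv h6, mvfderiv_eq_fderiv h6, h4.fderiv_eq]
  exact (h5.isSymmSndFDerivAt (by simpa using WithTop.coe_le_coe.2 (le_top : (2 : ℕ∞) ≤ ⊤))).eq v w

end Differential

section Koszul

variable {E : Type*} [NormedAddCommGroup E] [NormedSpace ℝ E]
  {H : Type*} [TopologicalSpace H] {I : ModelWithCorners ℝ E H}
  {M : Type*} [TopologicalSpace M] [ChartedSpace H M] [IsManifold I ∞ M]
  {E' : Type*} [NormedAddCommGroup E'] [NormedSpace ℝ E']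
  {H' : Type*} [TopologicalSpace H'] {I' : ModelWithCorners ℝ E' H'}
  {N : Type*} [TopologicalSpace N] [ChartedSpace H' N] [IsManifold I' ∞ N]

theorem trivializationAt_apply_eq (x : M) {y : M} (hy : y ∈ (chartAt H x).source)
    (v : TangentSpace I y) :
    (trivializationAt E (TangentSpace I) x ⟨y, v⟩).2 =
      (trivializationAt E (TangentSpace I) x).continuousLinearMapAt ℝ y v := by
  rw [Trivialization.continuousLinearMapAt_apply, Trivialization.linearMapAt_apply]
  exact (if_pos hy).symm

theorem continuousLinearMapAt_trivializationAt_self (x : M) (v : TangentSpace I x) :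
    (trivializationAt E (TangentSpace I) x).continuousLinearMapAt ℝ x v = v := by
  exact congrArg (fun L : E →L[ℝ] E => L v)
    ((TangentBundle.continuousLinearMapAt_trivializationAt (mem_chart_source H x)).trans
      (mfderiv_extChartAt_self (I := I) (x := x)))

theorem trivializationAt_self_apply (x : M) (v : TangentSpace I x) :
    (trivializationAt E (TangentSpace I) x ⟨x, v⟩).2 = v :=
  (trivializationAt_apply_eq x (mem_chart_source H x) v).trans
    (continuousLinearMapAt_trivializationAt_self x v)

theorem symmL_trivializationAt_self (x : M) (v : TangentSpace I x) :
    (trivializationAt E (TangentSpace I) x).symmL ℝ x v = v := by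
  conv_lhs => rw [← continuousLinearMapAt_trivializationAt_self x v]
  exact Trivialization.symmL_continuousLinearMapAt _ (mem_chart_source H x) v

theorem metricCoord_self (g : RiemannianMetric I M) (x : M) (v w : TangentSpace I x) :
    metricCoord g x x v w = g.inner x v w :=
  (metricCoord_apply g x x (mem_chart_source H x) v w).trans
    (congrArg₂ (fun a b => g.inner x a b) (symmL_trivializationAt_self x v)
      (symmL_trivializationAt_self x w))

theorem mfderivCoord_self {φ : M → N} (x : M) (v : TangentSpace I x) :
    mfderivCoord I I' φ x x v = mfderiv I I' φ x v := by
  change (trivializationAt E' (TangentSpace I') (φ x)).continuousLinearMapAt ℝ (φ x)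
    (mfderiv I I' φ x ((trivializationAt E (TangentSpace I) x).symmL ℝ x v)) = _
  rw [continuousLinearMapAt_trivializationAt_self, symmL_trivializationAt_self]

theorem trivializationAt_mfderiv {φ : M → N} {x y : M}
    (hy : y ∈ (chartAt H x).source) (hy' : φ y ∈ (chartAt H' (φ x)).source)
    (v : TangentSpace I y) :
    (trivializationAt E' (TangentSpace I') (φ x) ⟨φ y, mfderiv I I' φ y v⟩).2 =
      mfderivCoord I I' φ x y (trivializationAt E (TangentSpace I) x ⟨y, v⟩).2 := by
  rw [trivializationAt_apply_eq _ hy', trivializationAt_apply_eq _ hy]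
  change _ = (trivializationAt E' (TangentSpace I') (φ x)).continuousLinearMapAt ℝ (φ y)
    (mfderiv I I' φ y ((trivializationAt E (TangentSpace I) x).symmL ℝ y
      ((trivializationAt E (TangentSpace I) x).continuousLinearMapAt ℝ y v)))
  rw [Trivialization.symmL_continuousLinearMapAt _ hy]

theorem symmL_mfderivCoord {φ : M → N} {x y : M} (hy' : φ y ∈ (chartAt H' (φ x)).source) (v : E) :
    (trivializationAt E' (TangentSpace I') (φ x)).symmL ℝ (φ y) (mfderivCoord I I' φ x y v) =
      mfderiv I I' φ y ((trivializationAt E (TangentSpace I) x).symmL ℝ y v) :=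
  Trivialization.symmL_continuousLinearMapAt _ hy' _

theorem mdifferentiableAt_metricCoord (g : RiemannianMetric I M) (x : M) :
    MDifferentiableAt I 𝓘(ℝ, E →L[ℝ] E →L[ℝ] ℝ) (metricCoord g x) x :=
  ((contMDiffAt_section _).1 (g.contMDiff x)).mdifferentiableAt (by simp)

/-- The components at `y` of the pullback of the metric `g` by `φ`, in the chart at `x`. -/
def pullbackCoord (I : ModelWithCorners ℝ E H) [IsManifold I ∞ M] (g : RiemannianMetric I' N)
    (φ : M → N) (x y : M) : E →L[ℝ] E →L[ℝ] ℝ :=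
  (trivializationAt (E →L[ℝ] E →L[ℝ] ℝ)
    (fun q : M => TangentSpace I q →L[ℝ] TangentSpace I q →L[ℝ] ℝ) x ⟨y, pullbackInner g φ y⟩).2

theorem mdifferentiableAt_pullbackCoord (g : RiemannianMetric I' N) {φ : M → N}
    (hφ : ContMDiff I I' ∞ φ) (x : M) :
    MDifferentiableAt I 𝓘(ℝ, E →L[ℝ] E →L[ℝ] ℝ) (pullbackCoord I g φ x) x :=
  ((contMDiffAt_section _).1 (contMDiff_pullbackInner g φ hφ x)).mdifferentiableAt (by simp)

theorem pullbackCoord_eventually (g : RiemannianMetric I' N) {φ : M → N}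
    (hφ : ContMDiff I I' ∞ φ) (x : M) (v w : E) :
    ∀ᶠ y in nhds x, pullbackCoord I g φ x y v w =
      metricCoord g (φ x) (φ y) (mfderivCoord I I' φ x y v) (mfderivCoord I I' φ x y w) := by
  filter_upwards [eventually_mem_chartAt_source hφ x] with y hy
  rw [pullbackCoord, hom_coord_apply x y hy.1, pullbackInner_apply, metricCoord_apply _ _ _ hy.2,
    symmL_mfderivCoord hy.2, symmL_mfderivCoord hy.2]

/-- The product rule for the pullback metric `g(dφ b, dφ c)`. -/
theorem mvfderiv_pullbackCoord (g : RiemannianMetric I' N) {φ : M → N}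
    (hφ : ContMDiff I I' ∞ φ) (x : M) (a b c : TangentSpace I x) :
    mvfderiv I (pullbackCoord I g φ x) x a b c =
      mvfderiv I' (metricCoord g (φ x)) (φ x) (mfderiv I I' φ x a) (mfderiv I I' φ x b)
        (mfderiv I I' φ x c) +
      g.inner (φ x) (mvfderiv I (mfderivCoord I I' φ x) x a b) (mfderiv I I' φ x c) +
      g.inner (φ x) (mfderiv I I' φ x b) (mvfderiv I (mfderivCoord I I' φ x) x a c) := by
  have hh := mdifferentiableAt_pullbackCoord g hφ x
  have hG := mdifferentiableAt_metricCoord g (φ x)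
  have hφ' : MDifferentiableAt I I' φ x := (hφ x).mdifferentiableAt (by simp)
  have hG' : MDifferentiableAt I 𝓘(ℝ, E' →L[ℝ] E' →L[ℝ] ℝ) (fun y => metricCoord g (φ x) (φ y)) x :=
    hG.comp x hφ'
  have hA : MDifferentiableAt I 𝓘(ℝ, E →L[ℝ] E') (mfderivCoord I I' φ x) x :=
    (contMDiffAt_mfderivCoord hφ x).mdifferentiableAt (by simp)
  have hAc : ∀ u : E, MDifferentiableAt I 𝓘(ℝ, E') (fun y => mfderivCoord I I' φ x y u) x :=
    fun u => hA.clm_apply mdifferentiableAt_const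
  have h1 : MDifferentiableAt I 𝓘(ℝ, E →L[ℝ] ℝ) (fun y => pullbackCoord I g φ x y b) x :=
    hh.clm_apply mdifferentiableAt_const
  rw [← mvfderiv_apply_const hh b, ← mvfderiv_apply_const h1 c,
    mvfderiv_congr (pullbackCoord_eventually g hφ x b c),
    mvfderiv_clm_apply (hG'.clm_apply (hAc b)) (hAc c),
    mvfderiv_clm_apply hG' (hAc b), mvfderiv_apply_const hA b, mvfderiv_apply_const hA c,
    mfderivCoord_self, mfderivCoord_self]
  rw [mvfderiv_comp_vector hG hφ']
  have h4 := metricCoord_self g (φ x) (mvfderiv I (mfderivCoord I I' φ x) x a b)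
    (mfderiv I I' φ x c)
  have h5 := metricCoord_self g (φ x) (mfderiv I I' φ x b)
    (mvfderiv I (mfderivCoord I I' φ x) x a c)
  rw [← h4, ← h5]
  rfl

theorem mdifferentiableAt_trivializationAt_mfderiv {φ : M → N}
    (hφ : ContMDiff I I' ∞ φ) {x : M} {Y : ∀ x : M, TangentSpace I x}
    (hY : ContMDiffAt I (I.prod 𝓘(ℝ, E)) ∞ (fun y => (⟨y, Y y⟩ : TangentBundle I M)) x) :
    MDifferentiableAt I 𝓘(ℝ, E') (fun y => (trivializationAt E' (TangentSpace I') (φ x)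
      ⟨φ y, mfderiv I I' φ y (Y y)⟩).2) x := by
  have hA : MDifferentiableAt I 𝓘(ℝ, E →L[ℝ] E') (mfderivCoord I I' φ x) x :=
    (contMDiffAt_mfderivCoord hφ x).mdifferentiableAt (by simp)
  have hY' : MDifferentiableAt I 𝓘(ℝ, E)
      (fun y => (trivializationAt E (TangentSpace I) x ⟨y, Y y⟩).2) x :=
    ((contMDiffAt_section _).1 hY).mdifferentiableAt (by simp)
  refine (hA.clm_apply hY').congr_of_eventuallyEq ?_
  filter_upwards [eventually_mem_chartAt_source hφ x] with y hy
  exact trivializationAt_mfderiv hy.1 hy.2 _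

/-- The derivative, read in charts, of `dφ Y` for a vector field `Y` on `M`. -/
theorem mvfderiv_trivializationAt_mfderiv {φ : M → N}
    (hφ : ContMDiff I I' ∞ φ) {x : M} {Y : ∀ x : M, TangentSpace I x}
    (hY : ContMDiffAt I (I.prod 𝓘(ℝ, E)) ∞ (fun y => (⟨y, Y y⟩ : TangentBundle I M)) x)
    (v : TangentSpace I x) :
    mvfderiv I (fun y => (trivializationAt E' (TangentSpace I') (φ x)
      ⟨φ y, mfderiv I I' φ y (Y y)⟩).2) x v =
    mvfderiv I (mfderivCoord I I' φ x) x v (Y x) + mfderivCoord I I' φ x x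
      (mvfderiv I (fun y => (trivializationAt E (TangentSpace I) x ⟨y, Y y⟩).2) x v) := by
  have hA : MDifferentiableAt I 𝓘(ℝ, E →L[ℝ] E') (mfderivCoord I I' φ x) x :=
    (contMDiffAt_mfderivCoord hφ x).mdifferentiableAt (by simp)
  have hY' : MDifferentiableAt I 𝓘(ℝ, E)
      (fun y => (trivializationAt E (TangentSpace I) x ⟨y, Y y⟩).2) x :=
    ((contMDiffAt_section _).1 hY).mdifferentiableAt (by simp)
  have h : (fun y => (trivializationAt E' (TangentSpace I') (φ x)
      ⟨φ y, mfderiv I I' φ y (Y y)⟩).2) =ᶠ[nhds x] fun y => mfderivCoord I I' φ x y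
        (trivializationAt E (TangentSpace I) x ⟨y, Y y⟩).2 := by
    filter_upwards [eventually_mem_chartAt_source hφ x] with y hy
    exact trivializationAt_mfderiv hy.1 hy.2 _
  rw [mvfderiv_congr h, mvfderiv_clm_apply hA hY', trivializationAt_self_apply]
variable [FiniteDimensional ℝ E']

omit [FiniteDimensional ℝ E'] in
theorem koszul_apply (g : RiemannianMetric I' N) (p : N) (a b c : TangentSpace I' p) :
    koszul g p a b c = (mvfderiv I' (metricCoord g p) p a b c +
      mvfderiv I' (metricCoord g p) p b a c - mvfderiv I' (metricCoord g p) p c a b) / 2 := by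
  change (mvfderiv I' (metricCoord g p) p a _ _ + mvfderiv I' (metricCoord g p) p b _ _ -
    mvfderiv I' (metricCoord g p) p c _ _) / 2 = _
  simp only [continuousLinearMapAt_trivializationAt_self]

omit [IsManifold I ∞ M] in
theorem inner_covDerivAlong (g : RiemannianMetric I' N) (φ : M → N)
    (V : ∀ x : M, TangentSpace I' (φ x)) (x : M) (v : TangentSpace I x)
    (u : TangentSpace I' (φ x)) :
    g.inner (φ x) (covDerivAlong I g φ V x v) u =
      metricCoord g (φ x) (φ x) (mvfderiv I
        (fun y => (trivializationAt E' (TangentSpace I') (φ x) ⟨φ y, V y⟩).2) x v) u +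
      koszul g (φ x) (mfderiv I I' φ x v) (V x) u := by
  rw [covDerivAlong, map_add]
  refine congrArg₂ (· + ·) ?_ (inner_christoffel g _ _ _ u)
  exact (congrArg (fun a => g.inner (φ x) a u) (symmL_trivializationAt_self (φ x) _)).trans
    (metricCoord_self g (φ x) _ u).symm

/-- The Koszul formula: the tangential components of `∇_v (dφ Y)` are determined by the pullback
metric. -/
theorem inner_covDerivAlong_mfderiv [I.Boundaryless] (g : RiemannianMetric I' N) {φ : M → N}
    (hφ : ContMDiff I I' ∞ φ) {x : M} {Y : ∀ x : M, TangentSpace I x}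
    (hY : ContMDiffAt I (I.prod 𝓘(ℝ, E)) ∞ (fun y => (⟨y, Y y⟩ : TangentBundle I M)) x)
    (v w : TangentSpace I x) :
    g.inner (φ x) (covDerivAlong I g φ (fun y => mfderiv I I' φ y (Y y)) x v)
        (mfderiv I I' φ x w) =
      pullbackInner g φ x
        (mvfderiv I (fun y => (trivializationAt E (TangentSpace I) x ⟨y, Y y⟩).2) x v : E) w +
      (mvfderiv I (pullbackCoord I g φ x) x v (Y x) w +
        mvfderiv I (pullbackCoord I g φ x) x (Y x) v w -
        mvfderiv I (pullbackCoord I g φ x) x w v (Y x)) / 2 := by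
  have hs := g.symm (φ x)
  have h1 := mfderivCoord_self (φ := φ) (I := I) (I' := I') x
    (mvfderiv I (fun y => (trivializationAt E (TangentSpace I) x ⟨y, Y y⟩).2) x v)
  have h2 := metricCoord_self g (φ x) (mvfderiv I (mfderivCoord I I' φ x) x v (Y x))
    (mfderiv I I' φ x w)
  have h3 := metricCoord_self g (φ x) (mfderiv I I' φ x
    (mvfderiv I (fun y => (trivializationAt E (TangentSpace I) x ⟨y, Y y⟩).2) x v))
    (mfderiv I I' φ x w)
  have h4 := pullbackInner_apply (I := I) g φ x
    (mvfderiv I (fun y => (trivializationAt E (TangentSpace I) x ⟨y, Y y⟩).2) x v) w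
  have h5 := (metricCoord g (φ x) (φ x)).map_add₂ (mvfderiv I (mfderivCoord I I' φ x) x v (Y x))
    (mfderiv I I' φ x
      (mvfderiv I (fun y => (trivializationAt E (TangentSpace I) x ⟨y, Y y⟩).2) x v))
    (mfderiv I I' φ x w)
  rw [inner_covDerivAlong, mvfderiv_trivializationAt_mfderiv hφ hY, mvfderiv_pullbackCoord g hφ,
    mvfderiv_pullbackCoord g hφ, mvfderiv_pullbackCoord g hφ,
    mvfderiv_mfderivCoord_symm hφ x (Y x) v, mvfderiv_mfderivCoord_symm hφ x w v,
    mvfderiv_mfderivCoord_symm hφ x w (Y x), h4, koszul_apply, h1, h5, h2, h3,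
    hs (mfderiv I I' φ x (Y x)) (mvfderiv I (mfderivCoord I I' φ x) x v w),
    hs (mfderiv I I' φ x v) (mvfderiv I (mfderivCoord I I' φ x) x (Y x) w)]
  ring

end Koszul

section Product

variable {E₁ : Type*} [NormedAddCommGroup E₁] [NormedSpace ℝ E₁]
  {H₁ : Type*} [TopologicalSpace H₁] {I₁ : ModelWithCorners ℝ E₁ H₁}
  {M₁ : Type*} [TopologicalSpace M₁] [ChartedSpace H₁ M₁]
  {E₂ : Type*} [NormedAddCommGroup E₂] [NormedSpace ℝ E₂]
  {H₂ : Type*} [TopologicalSpace H₂] {I₂ : ModelWithCorners ℝ E₂ H₂}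
  {M₂ : Type*} [TopologicalSpace M₂] [ChartedSpace H₂ M₂]

theorem dfst_eq_fst (p : M₁ × M₂) (v : TangentSpace (I₁.prod I₂) p) :
    dfst I₁ I₂ p v = v.1 := by
  rw [dfst, mfderiv_fst]
  rfl

theorem dsnd_eq_snd (p : M₁ × M₂) (v : TangentSpace (I₁.prod I₂) p) :
    dsnd I₁ I₂ p v = v.2 := by
  rw [dsnd, mfderiv_snd]
  rfl

theorem dfst_dinl (p : M₁ × M₂) (v : TangentSpace I₁ p.1) :
    dfst I₁ I₂ p (dinl I₁ I₂ p v) = v := by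
  have h1 : dfst I₁ I₂ p =
      ContinuousLinearMap.fst ℝ (TangentSpace I₁ p.1) (TangentSpace I₂ p.2) := mfderiv_fst
  have h3 : dinl I₁ I₂ p =
      ContinuousLinearMap.inl ℝ (TangentSpace I₁ p.1) (TangentSpace I₂ p.2) := mfderiv_prod_left
  rw [h1, h3]
  rfl

theorem dsnd_dinl (p : M₁ × M₂) (v : TangentSpace I₁ p.1) :
    dsnd I₁ I₂ p (dinl I₁ I₂ p v) = 0 := by
  have h2 : dsnd I₁ I₂ p =
      ContinuousLinearMap.snd ℝ (TangentSpace I₁ p.1) (TangentSpace I₂ p.2) := mfderiv_snd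
  have h3 : dinl I₁ I₂ p =
      ContinuousLinearMap.inl ℝ (TangentSpace I₁ p.1) (TangentSpace I₂ p.2) := mfderiv_prod_left
  rw [h2, h3]
  rfl

theorem dfst_dinr (p : M₁ × M₂) (v : TangentSpace I₂ p.2) :
    dfst I₁ I₂ p (dinr I₁ I₂ p v) = 0 := by
  have h1 : dfst I₁ I₂ p =
      ContinuousLinearMap.fst ℝ (TangentSpace I₁ p.1) (TangentSpace I₂ p.2) := mfderiv_fst
  have h4 : dinr I₁ I₂ p =
      ContinuousLinearMap.inr ℝ (TangentSpace I₁ p.1) (TangentSpace I₂ p.2) := mfderiv_prod_right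
  rw [h1, h4]
  rfl

theorem dsnd_dinr (p : M₁ × M₂) (v : TangentSpace I₂ p.2) :
    dsnd I₁ I₂ p (dinr I₁ I₂ p v) = v := by
  have h2 : dsnd I₁ I₂ p =
      ContinuousLinearMap.snd ℝ (TangentSpace I₁ p.1) (TangentSpace I₂ p.2) := mfderiv_snd
  have h4 : dinr I₁ I₂ p =
      ContinuousLinearMap.inr ℝ (TangentSpace I₁ p.1) (TangentSpace I₂ p.2) := mfderiv_prod_right
  rw [h2, h4]
  rfl

theorem dfst_prodF (p : M₁ × M₂) (v : TangentSpace (I₁.prod I₂) p) :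
    dfst I₁ I₂ p (prodF I₁ I₂ p v) = dfst I₁ I₂ p v := by
  change dfst I₁ I₂ p (dinl I₁ I₂ p (dfst I₁ I₂ p v) - dinr I₁ I₂ p (dsnd I₁ I₂ p v)) = _
  rw [map_sub, dfst_dinl, dfst_dinr, sub_zero]

theorem dsnd_prodF (p : M₁ × M₂) (v : TangentSpace (I₁.prod I₂) p) :
    dsnd I₁ I₂ p (prodF I₁ I₂ p v) = -dsnd I₁ I₂ p v := by
  change dsnd I₁ I₂ p (dinl I₁ I₂ p (dfst I₁ I₂ p v) - dinr I₁ I₂ p (dsnd I₁ I₂ p v)) = _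
  rw [map_sub, dsnd_dinl, dsnd_dinr, zero_sub]

theorem prodF_injective (p : M₁ × M₂) : Function.Injective (prodF I₁ I₂ p) := by
  intro v w h
  have h1 := congrArg (dfst I₁ I₂ p) h
  have h2 := congrArg (dsnd I₁ I₂ p) h
  rw [dfst_prodF, dfst_prodF] at h1
  rw [dsnd_prodF, dsnd_prodF, neg_inj] at h2
  rw [← dinl_dfst_add_dinr_dsnd p v, h1, h2, dinl_dfst_add_dinr_dsnd]

variable [IsManifold I₁ ∞ M₁] [IsManifold I₂ ∞ M₂]

theorem prodMetric_apply (g₁ : RiemannianMetric I₁ M₁) (g₂ : RiemannianMetric I₂ M₂)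
    (p : M₁ × M₂) (v w : TangentSpace (I₁.prod I₂) p) :
    (prodMetric g₁ g₂).inner p v w = g₁.inner p.1 (dfst I₁ I₂ p v) (dfst I₁ I₂ p w) +
      g₂.inner p.2 (dsnd I₁ I₂ p v) (dsnd I₁ I₂ p w) := rfl

theorem continuousLinearMapAt_prod_fst {p q : M₁ × M₂}
    (hq : q ∈ (chartAt (ModelProd H₁ H₂) p).source) (v : TangentSpace (I₁.prod I₂) q) :
    ((trivializationAt (E₁ × E₂) (TangentSpace (I₁.prod I₂)) p).continuousLinearMapAt ℝ q v).1 =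
      (trivializationAt E₁ (TangentSpace I₁) p.1).continuousLinearMapAt ℝ q.1
        (dfst I₁ I₂ q v) := by
  have h1 := mdifferentiableAt_extChartAt (I := I₁.prod I₂) hq
  have h2 := mdifferentiableAt_extChartAt (I := I₁) (x := p.1) (y := q.1) hq.1
  rw [TangentBundle.continuousLinearMapAt_trivializationAt hq,
    TangentBundle.continuousLinearMapAt_trivializationAt hq.1]
  have h3 := mvfderiv_const_clm_apply (ContinuousLinearMap.fst ℝ E₁ E₂) h1 v
  exact h3.symm.trans (mvfderiv_comp_vector h2 (mdifferentiableAt_fst (I := I₁) (I' := I₂)) v)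

theorem continuousLinearMapAt_prod_snd {p q : M₁ × M₂}
    (hq : q ∈ (chartAt (ModelProd H₁ H₂) p).source) (v : TangentSpace (I₁.prod I₂) q) :
    ((trivializationAt (E₁ × E₂) (TangentSpace (I₁.prod I₂)) p).continuousLinearMapAt ℝ q v).2 =
      (trivializationAt E₂ (TangentSpace I₂) p.2).continuousLinearMapAt ℝ q.2
        (dsnd I₁ I₂ q v) := by
  have h1 := mdifferentiableAt_extChartAt (I := I₁.prod I₂) hq
  have h2 := mdifferentiableAt_extChartAt (I := I₂) (x := p.2) (y := q.2) hq.2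
  rw [TangentBundle.continuousLinearMapAt_trivializationAt hq,
    TangentBundle.continuousLinearMapAt_trivializationAt hq.2]
  have h3 := mvfderiv_const_clm_apply (ContinuousLinearMap.snd ℝ E₁ E₂) h1 v
  exact h3.symm.trans (mvfderiv_comp_vector h2 (mdifferentiableAt_snd (I := I₁) (I' := I₂)) v)

theorem dfst_symmL {p q : M₁ × M₂} (hq : q ∈ (chartAt (ModelProd H₁ H₂) p).source)
    (v : E₁ × E₂) :
    dfst I₁ I₂ q
        ((trivializationAt (E₁ × E₂) (TangentSpace (I₁.prod I₂)) p).symmL ℝ q v) =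
      (trivializationAt E₁ (TangentSpace I₁) p.1).symmL ℝ q.1 v.1 := by
  rw [← Trivialization.symmL_continuousLinearMapAt (R := ℝ)
    (trivializationAt E₁ (TangentSpace I₁) p.1) (b := q.1) hq.1 (dfst I₁ I₂ q _),
    ← continuousLinearMapAt_prod_fst hq, Trivialization.continuousLinearMapAt_symmL _ hq]

theorem dsnd_symmL {p q : M₁ × M₂} (hq : q ∈ (chartAt (ModelProd H₁ H₂) p).source)
    (v : E₁ × E₂) :
    dsnd I₁ I₂ q
        ((trivializationAt (E₁ × E₂) (TangentSpace (I₁.prod I₂)) p).symmL ℝ q v) =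
      (trivializationAt E₂ (TangentSpace I₂) p.2).symmL ℝ q.2 v.2 := by
  rw [← Trivialization.symmL_continuousLinearMapAt (R := ℝ)
    (trivializationAt E₂ (TangentSpace I₂) p.2) (b := q.2) hq.2 (dsnd I₁ I₂ q _),
    ← continuousLinearMapAt_prod_snd hq, Trivialization.continuousLinearMapAt_symmL _ hq]

theorem metricCoord_prodMetric (g₁ : RiemannianMetric I₁ M₁) (g₂ : RiemannianMetric I₂ M₂)
    {p q : M₁ × M₂} (hq : q ∈ (chartAt (ModelProd H₁ H₂) p).source) (v w : E₁ × E₂) :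
    metricCoord (prodMetric g₁ g₂) p q v w =
      metricCoord g₁ p.1 q.1 v.1 w.1 + metricCoord g₂ p.2 q.2 v.2 w.2 := by
  rw [metricCoord_apply _ p q hq, prodMetric_apply, metricCoord_apply g₁ _ _ hq.1,
    metricCoord_apply g₂ _ _ hq.2, dfst_symmL hq, dfst_symmL hq, dsnd_symmL hq, dsnd_symmL hq]

theorem mvfderiv_metricCoord_prodMetric (g₁ : RiemannianMetric I₁ M₁)
    (g₂ : RiemannianMetric I₂ M₂) (p : M₁ × M₂) (a b c : TangentSpace (I₁.prod I₂) p) :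
    mvfderiv (I₁.prod I₂) (metricCoord (prodMetric g₁ g₂) p) p a b c =
      mvfderiv I₁ (metricCoord g₁ p.1) p.1 (dfst I₁ I₂ p a) (dfst I₁ I₂ p b) (dfst I₁ I₂ p c) +
      mvfderiv I₂ (metricCoord g₂ p.2) p.2 (dsnd I₁ I₂ p a) (dsnd I₁ I₂ p b)
        (dsnd I₁ I₂ p c) := by
  have hG := mdifferentiableAt_metricCoord (prodMetric g₁ g₂) p
  have hG₁ := mdifferentiableAt_metricCoord g₁ p.1
  have hG₂ := mdifferentiableAt_metricCoord g₂ p.2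
  have hf : MDifferentiableAt (I₁.prod I₂) I₁ (Prod.fst : M₁ × M₂ → M₁) p := mdifferentiableAt_fst
  have hs : MDifferentiableAt (I₁.prod I₂) I₂ (Prod.snd : M₁ × M₂ → M₂) p := mdifferentiableAt_snd
  have hG₁' : MDifferentiableAt (I₁.prod I₂) 𝓘(ℝ, E₁ →L[ℝ] E₁ →L[ℝ] ℝ)
      (fun q : M₁ × M₂ => metricCoord g₁ p.1 q.1) p := hG₁.comp p hf
  have hG₂' : MDifferentiableAt (I₁.prod I₂) 𝓘(ℝ, E₂ →L[ℝ] E₂ →L[ℝ] ℝ)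
      (fun q : M₁ × M₂ => metricCoord g₂ p.2 q.2) p := hG₂.comp p hs
  obtain ⟨b₁, b₂⟩ : E₁ × E₂ := b
  obtain ⟨c₁, c₂⟩ : E₁ × E₂ := c
  have h1 : mvfderiv (I₁.prod I₂) (fun q => metricCoord (prodMetric g₁ g₂) p q (b₁, b₂) (c₁, c₂))
      p a = mvfderiv (I₁.prod I₂) (metricCoord (prodMetric g₁ g₂) p) p a (b₁, b₂) (c₁, c₂) := by
    rw [mvfderiv_apply_const (hG.clm_apply mdifferentiableAt_const), mvfderiv_apply_const hG]
  have h2 : mvfderiv (I₁.prod I₂) (fun q : M₁ × M₂ => metricCoord g₁ p.1 q.1 b₁ c₁) p a =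
      mvfderiv I₁ (metricCoord g₁ p.1) p.1 (dfst I₁ I₂ p a) b₁ c₁ := by
    rw [mvfderiv_apply_const (hG₁'.clm_apply mdifferentiableAt_const), mvfderiv_apply_const hG₁',
      mvfderiv_comp_vector hG₁ hf]
    rfl
  have h3 : mvfderiv (I₁.prod I₂) (fun q : M₁ × M₂ => metricCoord g₂ p.2 q.2 b₂ c₂) p a =
      mvfderiv I₂ (metricCoord g₂ p.2) p.2 (dsnd I₁ I₂ p a) b₂ c₂ := by
    rw [mvfderiv_apply_const (hG₂'.clm_apply mdifferentiableAt_const), mvfderiv_apply_const hG₂',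
      mvfderiv_comp_vector hG₂ hs]
    rfl
  have h4 : (fun q => metricCoord (prodMetric g₁ g₂) p q (b₁, b₂) (c₁, c₂)) =ᶠ[nhds p]
      fun q => metricCoord g₁ p.1 q.1 b₁ c₁ + metricCoord g₂ p.2 q.2 b₂ c₂ := by
    filter_upwards [(chartAt (ModelProd H₁ H₂) p).open_source.mem_nhds (mem_chart_source _ p)]
      with q hq
    exact metricCoord_prodMetric g₁ g₂ hq _ _
  have h5 := congrArg (fun L : E₁ × E₂ →L[ℝ] ℝ => L a) (mvfderiv_fun_add
    ((hG₁'.clm_apply (mdifferentiableAt_const (c := b₁))).clm_apply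
      (mdifferentiableAt_const (c := c₁)))
    ((hG₂'.clm_apply (mdifferentiableAt_const (c := b₂))).clm_apply
      (mdifferentiableAt_const (c := c₂))))
  have h6 : mvfderiv (I₁.prod I₂) (fun q : M₁ × M₂ => metricCoord g₁ p.1 q.1 b₁ c₁ +
      metricCoord g₂ p.2 q.2 b₂ c₂) p a = _ := h5
  rw [dfst_eq_fst p (b₁, b₂), dfst_eq_fst p (c₁, c₂), dsnd_eq_snd p (b₁, b₂),
    dsnd_eq_snd p (c₁, c₂)]
  refine h1.symm.trans ((mvfderiv_congr h4 a).trans (h6.trans ?_))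
  exact congrArg₂ (· + ·) h2 h3

end Product

section Product

variable {E₁ : Type*} [NormedAddCommGroup E₁] [NormedSpace ℝ E₁] [FiniteDimensional ℝ E₁]
  {H₁ : Type*} [TopologicalSpace H₁] {I₁ : ModelWithCorners ℝ E₁ H₁}
  {M₁ : Type*} [TopologicalSpace M₁] [ChartedSpace H₁ M₁] [IsManifold I₁ ∞ M₁]
  {E₂ : Type*} [NormedAddCommGroup E₂] [NormedSpace ℝ E₂] [FiniteDimensional ℝ E₂]
  {H₂ : Type*} [TopologicalSpace H₂] {I₂ : ModelWithCorners ℝ E₂ H₂}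
  {M₂ : Type*} [TopologicalSpace M₂] [ChartedSpace H₂ M₂] [IsManifold I₂ ∞ M₂]
  {E : Type*} [NormedAddCommGroup E] [NormedSpace ℝ E]
  {H : Type*} [TopologicalSpace H] {I : ModelWithCorners ℝ E H}
  {M : Type*} [TopologicalSpace M] [ChartedSpace H M]

omit [FiniteDimensional ℝ E₁] [FiniteDimensional ℝ E₂] in
theorem koszul_prodMetric (g₁ : RiemannianMetric I₁ M₁) (g₂ : RiemannianMetric I₂ M₂)
    (p : M₁ × M₂) (a b c : TangentSpace (I₁.prod I₂) p) :
    koszul (prodMetric g₁ g₂) p a b c =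
      koszul g₁ p.1 (dfst I₁ I₂ p a) (dfst I₁ I₂ p b) (dfst I₁ I₂ p c) +
      koszul g₂ p.2 (dsnd I₁ I₂ p a) (dsnd I₁ I₂ p b) (dsnd I₁ I₂ p c) := by
  rw [koszul_apply, koszul_apply, koszul_apply, mvfderiv_metricCoord_prodMetric,
    mvfderiv_metricCoord_prodMetric, mvfderiv_metricCoord_prodMetric]
  ring

omit [FiniteDimensional ℝ E₁] [FiniteDimensional ℝ E₂] [IsManifold I₁ ∞ M₁]
  [IsManifold I₂ ∞ M₂] in
theorem mfderiv_fst_comp {φ : M → M₁ × M₂} {x : M}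
    (hφ : MDifferentiableAt I (I₁.prod I₂) φ x) (v : TangentSpace I x) :
    mfderiv I I₁ (fun y => (φ y).1) x v = dfst I₁ I₂ (φ x) (mfderiv I (I₁.prod I₂) φ x v) :=
  mfderiv_comp_apply x (g := Prod.fst) (mdifferentiableAt_fst (I := I₁) (I' := I₂)) hφ v

omit [FiniteDimensional ℝ E₁] [FiniteDimensional ℝ E₂] [IsManifold I₁ ∞ M₁]
  [IsManifold I₂ ∞ M₂] in
theorem mfderiv_snd_comp {φ : M → M₁ × M₂} {x : M}
    (hφ : MDifferentiableAt I (I₁.prod I₂) φ x) (v : TangentSpace I x) :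
    mfderiv I I₂ (fun y => (φ y).2) x v = dsnd I₁ I₂ (φ x) (mfderiv I (I₁.prod I₂) φ x v) :=
  mfderiv_comp_apply x (g := Prod.snd) (mdifferentiableAt_snd (I := I₁) (I' := I₂)) hφ v

/-- The Levi-Civita connection of a product splits. -/
theorem inner_covDerivAlong_prod (g₁ : RiemannianMetric I₁ M₁) (g₂ : RiemannianMetric I₂ M₂)
    {φ : M → M₁ × M₂} {x : M} (hφ : MDifferentiableAt I (I₁.prod I₂) φ x)
    {V : ∀ y : M, TangentSpace (I₁.prod I₂) (φ y)}
    (hV : MDifferentiableAt I 𝓘(ℝ, E₁ × E₂)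
      (fun y => (trivializationAt (E₁ × E₂) (TangentSpace (I₁.prod I₂)) (φ x) ⟨φ y, V y⟩).2) x)
    (v : TangentSpace I x) (u : TangentSpace (I₁.prod I₂) (φ x)) :
    (prodMetric g₁ g₂).inner (φ x) (covDerivAlong I (prodMetric g₁ g₂) φ V x v) u =
      g₁.inner (φ x).1 (covDerivAlong I g₁ (fun y => (φ y).1)
        (fun y => dfst I₁ I₂ (φ y) (V y)) x v) (dfst I₁ I₂ (φ x) u) +
      g₂.inner (φ x).2 (covDerivAlong I g₂ (fun y => (φ y).2)
        (fun y => dsnd I₁ I₂ (φ y) (V y)) x v) (dsnd I₁ I₂ (φ x) u) := by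
  have hmem : ∀ᶠ y in nhds x, φ y ∈ (chartAt (ModelProd H₁ H₂) (φ x)).source :=
    hφ.continuousAt ((chartAt (ModelProd H₁ H₂) (φ x)).open_source.mem_nhds
      (mem_chart_source _ (φ x)))
  have h1 : (mvfderiv I (fun y => (trivializationAt (E₁ × E₂) (TangentSpace (I₁.prod I₂)) (φ x)
      ⟨φ y, V y⟩).2) x v).1 = mvfderiv I (fun y => (trivializationAt E₁ (TangentSpace I₁) (φ x).1
      ⟨(φ y).1, dfst I₁ I₂ (φ y) (V y)⟩).2) x v := by
    refine (mvfderiv_const_clm_apply (ContinuousLinearMap.fst ℝ E₁ E₂) hV v).symm.trans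
      (mvfderiv_congr ?_ v)
    filter_upwards [hmem] with y hy
    rw [trivializationAt_apply_eq _ hy, trivializationAt_apply_eq _ hy.1]
    exact continuousLinearMapAt_prod_fst hy _
  have h2 : (mvfderiv I (fun y => (trivializationAt (E₁ × E₂) (TangentSpace (I₁.prod I₂)) (φ x)
      ⟨φ y, V y⟩).2) x v).2 = mvfderiv I (fun y => (trivializationAt E₂ (TangentSpace I₂) (φ x).2
      ⟨(φ y).2, dsnd I₁ I₂ (φ y) (V y)⟩).2) x v := by
    refine (mvfderiv_const_clm_apply (ContinuousLinearMap.snd ℝ E₁ E₂) hV v).symm.trans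
      (mvfderiv_congr ?_ v)
    filter_upwards [hmem] with y hy
    rw [trivializationAt_apply_eq _ hy, trivializationAt_apply_eq _ hy.2]
    exact continuousLinearMapAt_prod_snd hy _
  have h3 := metricCoord_prodMetric g₁ g₂ (mem_chart_source (ModelProd H₁ H₂) (φ x))
    (mvfderiv I (fun y => (trivializationAt (E₁ × E₂) (TangentSpace (I₁.prod I₂)) (φ x)
      ⟨φ y, V y⟩).2) x v) u
  rw [h1, h2] at h3
  have h4 := inner_covDerivAlong g₁ (fun y => (φ y).1) (fun y => dfst I₁ I₂ (φ y) (V y)) x v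
    (dfst I₁ I₂ (φ x) u)
  have h5 := inner_covDerivAlong g₂ (fun y => (φ y).2) (fun y => dsnd I₁ I₂ (φ y) (V y)) x v
    (dsnd I₁ I₂ (φ x) u)
  rw [h4, h5, inner_covDerivAlong, h3, koszul_prodMetric,
    mfderiv_fst_comp hφ, mfderiv_snd_comp hφ, dfst_eq_fst (φ x) u, dsnd_eq_snd (φ x) u]
  ring

variable [IsManifold I ∞ M]

omit [FiniteDimensional ℝ E₁] [FiniteDimensional ℝ E₂] [IsManifold I ∞ M] in
/-- `F`-anti-invariance of a submanifold of a product says that both projections induce the same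
metric on it. -/
theorem IsAntiInvariant.pullbackInner_eq {g₁ : RiemannianMetric I₁ M₁}
    {g₂ : RiemannianMetric I₂ M₂} {φ : M → M₁ × M₂} (hφ : ContMDiff I (I₁.prod I₂) ∞ φ)
    (hF : IsAntiInvariant I (prodMetric g₁ g₂) (prodF I₁ I₂) φ) :
    pullbackInner (I := I) g₁ (fun y => (φ y).1) = pullbackInner (I := I) g₂ (fun y => (φ y).2) := by
  funext x
  refine ContinuousLinearMap.ext fun v => ContinuousLinearMap.ext fun w => ?_
  have hd : MDifferentiableAt I (I₁.prod I₂) φ x := (hφ x).mdifferentiableAt (by simp)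
  have h : (prodMetric g₁ g₂).inner (φ x) (mfderiv I (I₁.prod I₂) φ x v)
      (prodF I₁ I₂ (φ x) (mfderiv I (I₁.prod I₂) φ x w)) = 0 := hF x w _ ⟨v, rfl⟩
  rw [prodMetric_apply, dfst_prodF, dsnd_prodF, map_neg] at h
  rw [pullbackInner_apply, pullbackInner_apply, mfderiv_fst_comp hd, mfderiv_fst_comp hd,
    mfderiv_snd_comp hd, mfderiv_snd_comp hd]
  linarith

/-- For an `F`-anti-invariant submanifold, `g(∇_v (dφ Y), F dφ w) = 0`. -/
theorem IsAntiInvariant.inner_covDerivAlong_prodF [I.Boundaryless] {g₁ : RiemannianMetric I₁ M₁}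
    {g₂ : RiemannianMetric I₂ M₂} {φ : M → M₁ × M₂} (hφ : ContMDiff I (I₁.prod I₂) ∞ φ)
    (hF : IsAntiInvariant I (prodMetric g₁ g₂) (prodF I₁ I₂) φ) {x : M}
    {Y : ∀ x : M, TangentSpace I x}
    (hY : ContMDiffAt I (I.prod 𝓘(ℝ, E)) ∞ (fun y => (⟨y, Y y⟩ : TangentBundle I M)) x)
    (v w : TangentSpace I x) :
    (prodMetric g₁ g₂).inner (φ x)
      (covDerivAlong I (prodMetric g₁ g₂) φ (fun y => mfderiv I (I₁.prod I₂) φ y (Y y)) x v)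
      (prodF I₁ I₂ (φ x) (mfderiv I (I₁.prod I₂) φ x w)) = 0 := by
  have hd : ∀ y, MDifferentiableAt I (I₁.prod I₂) φ y := fun y =>
    (hφ y).mdifferentiableAt (by simp)
  have hφ₁ : ContMDiff I I₁ ∞ (fun y => (φ y).1) := contMDiff_fst.comp hφ
  have hφ₂ : ContMDiff I I₂ ∞ (fun y => (φ y).2) := contMDiff_snd.comp hφ
  rw [inner_covDerivAlong_prod g₁ g₂ (hd x) (mdifferentiableAt_trivializationAt_mfderiv hφ hY),
    dfst_prodF, dsnd_prodF, map_neg, ← mfderiv_fst_comp (hd x), ← mfderiv_snd_comp (hd x)]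
  simp only [← fun y => mfderiv_fst_comp (hd y) (Y y), ← fun y => mfderiv_snd_comp (hd y) (Y y)]
  have h1 := inner_covDerivAlong_mfderiv g₁ hφ₁ hY v w
  have h2 := inner_covDerivAlong_mfderiv g₂ hφ₂ hY v w
  have h3 : pullbackCoord I g₁ (fun y => (φ y).1) x = pullbackCoord I g₂ (fun y => (φ y).2) x := by
    unfold pullbackCoord
    rw [hF.pullbackInner_eq hφ]
  rw [h3, hF.pullbackInner_eq hφ] at h1
  rw [← sub_eq_add_neg, sub_eq_zero]
  exact h1.trans h2.symm

end Product

section Normal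

variable {E : Type*} [NormedAddCommGroup E] [NormedSpace ℝ E] [FiniteDimensional ℝ E]
  {H : Type*} [TopologicalSpace H] {I : ModelWithCorners ℝ E H}
  {N : Type*} [TopologicalSpace N] [ChartedSpace H N] [IsManifold I ∞ N]
  {E' : Type*} [NormedAddCommGroup E'] [NormedSpace ℝ E']
  {H' : Type*} [TopologicalSpace H'] {I' : ModelWithCorners ℝ E' H'}
  {M : Type*} [TopologicalSpace M] [ChartedSpace H' M]

/-- A vector orthogonal to the normal space has no normal part. -/
theorem normalPart_eq_zero (g : RiemannianMetric I N) (φ : M → N) (x : M)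
    (u : TangentSpace I (φ x))
    (hu : ∀ n ∈ normalSpace I' g φ x, g.inner (φ x) u n = 0) :
    normalPart I' g φ x u = 0 := by
  have h1 : normalPart I' g φ x u ∈ normalSpace I' g φ x :=
    Submodule.projection_apply_mem (isCompl_normalSpace (I' := I') g φ x) u
  have h2 : u - normalPart I' g φ x u ∈ tangentImage I' I φ x := by
    rw [normalPart, sub_eq_iff_eq_add'.2 (Submodule.projection_add_projection_eq_self
      (isCompl_normalSpace (I' := I') g φ x) u).symm]
    exact Submodule.projection_apply_mem (isCompl_normalSpace (I' := I') g φ x).symm u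
  refine form_eq_zero g (φ x) _ ?_
  have h3 := h1 _ h2
  have h4 : g.inner (φ x) (u - normalPart I' g φ x u) (normalPart I' g φ x u) = 0 := h3
  rw [map_sub, sub_apply, hu _ h1, zero_sub, neg_eq_zero] at h4
  exact h4

/-- If `M` has half the dimension of `N` and the injective field `F` maps tangent vectors to normal
vectors, then every normal vector is the image by `F` of a tangent vector. -/
theorem IsAntiInvariant.exists_of_mem_normalSpace {g : RiemannianMetric I N}
    {F : ∀ p : N, TangentSpace I p →L[ℝ] TangentSpace I p} {φ : M → N}
    (hF : IsAntiInvariant I' g F φ) (hFi : ∀ p, Function.Injective (F p))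
    (hdim : 2 * Module.finrank ℝ E' = Module.finrank ℝ E) {x : M}
    (hx : Function.Injective (mfderiv I' I φ x)) {n : TangentSpace I (φ x)}
    (hn : n ∈ normalSpace I' g φ x) : ∃ w, F (φ x) (mfderiv I' I φ x w) = n := by
  have : FiniteDimensional ℝ (TangentSpace I (φ x)) := inferInstanceAs (FiniteDimensional ℝ E)
  let L : TangentSpace I' x →ₗ[ℝ] TangentSpace I (φ x) :=
    (F (φ x)).toLinearMap ∘ₗ (mfderiv I' I φ x).toLinearMap
  have hL : Function.Injective L := (hFi (φ x)).comp hx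
  have h1 : LinearMap.range L ≤ normalSpace I' g φ x := by
    rintro _ ⟨w, rfl⟩
    exact hF x w
  have h2 : Module.finrank ℝ (LinearMap.range L) = Module.finrank ℝ E' :=
    LinearMap.finrank_range_of_inj hL
  have h3 : Module.finrank ℝ (tangentImage I' I φ x) = Module.finrank ℝ E' :=
    LinearMap.finrank_range_of_inj hx
  have h4 : Module.finrank ℝ (normalSpace I' g φ x) + Module.finrank ℝ (tangentImage I' I φ x) =
    Module.finrank ℝ E := Submodule.finrank_add_eq_of_isCompl (isCompl_normalSpace g φ x)
  have h5 : LinearMap.range L = normalSpace I' g φ x :=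
    Submodule.eq_of_le_of_finrank_eq h1 (by omega)
  rw [← h5] at hn
  exact hn

end Normal

end KahlerProduct

end

theorem theorem4p2
    {E₁ : Type*} [NormedAddCommGroup E₁] [NormedSpace ℝ E₁] [FiniteDimensional ℝ E₁]
    {M₁ : Type*} [TopologicalSpace M₁] [ChartedSpace E₁ M₁] [IsManifold 𝓘(ℝ, E₁) ∞ M₁]
    {E₂ : Type*} [NormedAddCommGroup E₂] [NormedSpace ℝ E₂] [FiniteDimensional ℝ E₂]
    {M₂ : Type*} [TopologicalSpace M₂] [ChartedSpace E₂ M₂] [IsManifold 𝓘(ℝ, E₂) ∞ M₂]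
    (K₁ : KahlerProduct.KahlerStructure 𝓘(ℝ, E₁) M₁)
    (K₂ : KahlerProduct.KahlerStructure 𝓘(ℝ, E₂) M₂)
    {E : Type*} [NormedAddCommGroup E] [NormedSpace ℝ E] [FiniteDimensional ℝ E]
    {M : Type*} [TopologicalSpace M] [ChartedSpace E M] [IsManifold 𝓘(ℝ, E) ∞ M]
    (φ : M → M₁ × M₂)
    (hφ : KahlerProduct.IsSmoothImmersion 𝓘(ℝ, E) (𝓘(ℝ, E₁).prod 𝓘(ℝ, E₂)) φ)
    (hF : KahlerProduct.IsAntiInvariant 𝓘(ℝ, E)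
      (KahlerProduct.prodMetric K₁.metric K₂.metric)
      (KahlerProduct.prodF 𝓘(ℝ, E₁) 𝓘(ℝ, E₂)) φ)
    (hL : KahlerProduct.IsLagrangian 𝓘(ℝ, E)
      (KahlerProduct.prodMetric K₁.metric K₂.metric)
      (KahlerProduct.prodJ K₁.J K₂.J) φ) :
    KahlerProduct.IsTotallyGeodesic 𝓘(ℝ, E)
      (KahlerProduct.prodMetric K₁.metric K₂.metric) φ := by
  intro x v Y hY
  refine KahlerProduct.normalPart_eq_zero _ φ x _ fun n hn => ?_
  obtain ⟨w, rfl⟩ := hF.exists_of_mem_normalSpace KahlerProduct.prodF_injective hL.1 (hφ.2 x) hn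
  exact hF.inner_covDerivAlong_prodF hφ.1 hY v w
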